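/- Let $N\ge 1$ and let $h:\mathbb{P}^N(\overline{\mathbb{Q}})\to\mathbb{R}_{\ge 0}$ be the absolute logarithmic Weil height. An endomorphism $\phi$ of $\mathbb{P}^N$ over $\overline{\mathbb{Q}}$ is a map given by homogeneous polynomials of a common degree $\deg(\phi)$ without common zero other than the origin; put $$C(\phi)=\sup_{P\in\mathbb{P}^N(\overline{\mathbb{Q}})}\bigl|h(\phi(P))-\deg(\phi)\,h(P)\bigr|.$$ A set $S$ of endomorphisms is called height controlled if $\inf_{\phi\in S}\deg(\phi)\ge 2$ and $\sup_{\phi\in S}C(\phi)<\infty$. Let $S$ be a height controlled set of endomorphisms of $\mathbb{P}^N(\overline{\mathbb{Q}})$, all defined over one fixed number field $K$. For a sequence $\gamma=(\theta_1,\theta_2,\dots)$ of elements of $S$ and $n\ge 0$ put $$\gamma_n^+=\theta_1\circ\theta_2\circ\dots\circ\theta_n,\qquad \gamma_n^-=\theta_n\circ\theta_{n-1}\circ\dots\circ\theta_1$$ (the identity if $n=0$), and let $\mathrm{Orb}_\gamma^+(P)=\{\gamma_n^+(P):n\ge 0\}$ and $\mathrm{Orb}_S(P)=\{f(P):f\in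 M_S\}$, where $M_S$ is the monoid generated by $S$ under composition. (1) There is a constant $B$ such that, for all $P\in\mathbb{P}^N(\overline{\mathbb{Q}})$ and all sequences $\gamma$ in $S$, both $$\liminf_{n\to\infty}\frac{h(\gamma_n^+(P))}{\deg(\gamma_n^+)}\quad\text{and}\quad\limsup_{n\to\infty}\frac{h(\gamma_n^+(P))}{\deg(\gamma_n^+)}$$ are finite and differ from $h(P)$ by at most $B$. Let moreover $\nu$ be a discrete probability measure on $S$ with $\nu(\phi)>0$ for all $\phi\in S$, and let $\bar\nu=\prod_{i\ge1}\nu$ be the product measure on the set $S^{\mathbb{N}}$ of sequences $\gamma$. (2) For all $P\in\mathbb{P}^N(\overline{\mathbb{Q}})$, the total orbit $\mathrm{Orb}_S(P)$ is infinite if and only if $$0<\limsup_{n\to\infty}\frac{h(\gamma_n^+(P))}{\deg(\gamma_n^+)}\quad\text{for }\bar\nu\text{-almost every }\gamma;$$ and $\mathrm{Orb}_S(P)$ is finite if and only if $\mathrm{Orb}_\gamma^+(P)$ is finite with positive $\bar\nu$-probability. (3) Suppose that $\mathbb{E}_\nu[\log\deg(\phi)]$ exists (that is, $\log\deg$ is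 $\nu$-integrable). Then the dynamical degree $\delta_{S,\nu}$, that is, the constant with $\lim_n\deg(\gamma_n^-)^{1/n}=\delta_{S,\nu}=\lim_n\deg(\gamma_n^+)^{1/n}$ for $\bar\nu$-almost every $\gamma$, exists and is equal to $\exp(\mathbb{E}_\nu[\log\deg(\phi)])$. If moreover $\mathrm{Orb}_S(P)$ is infinite for a point $P\in\mathbb{P}^N(\overline{\mathbb{Q}})$, then $$\limsup_{n\to\infty}h(\gamma_n^+(P))^{1/n}=\delta_{S,\nu}\quad\text{for }\bar\nu\text{-almost every }\gamma.$$ -/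

import Mathlib

open MeasureTheory Filter

noncomputable section

/-- The field of algebraic numbers. -/
abbrev QBar : Type := AlgebraicClosure ℚ

instance QBar_isAlgebraic : Algebra.IsAlgebraic ℚ QBar := AlgebraicClosure.isAlgebraic ℚ

/-- The points of projective `N`-space over the field of algebraic numbers. -/
abbrev PN (N : ℕ) : Type := Projectivization QBar (Fin (N + 1) → QBar)

/-- The number field generated by the entries of a vector of algebraic numbers. -/
def coordField {N : ℕ} (x : Fin (N + 1) → QBar) : IntermediateField ℚ QBar :=
  IntermediateField.adjoin ℚ (Set.range x)

instance coordField_finiteDimensional {N : ℕ} (x : Fin (N + 1) → QBar) :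
    FiniteDimensional ℚ (coordField x) :=
  haveI : Finite (Set.range x) := Set.finite_range x
  IntermediateField.finiteDimensional_adjoin
    (fun y _ => (Algebra.IsAlgebraic.isAlgebraic (R := ℚ) y).isIntegral)

instance coordField_numberField {N : ℕ} (x : Fin (N + 1) → QBar) :
    NumberField (coordField x) where

/-- The entries of `x`, as elements of the number field that they generate. -/
def coordVec {N : ℕ} (x : Fin (N + 1) → QBar) : Fin (N + 1) → coordField x :=
  fun i => ⟨x i, IntermediateField.subset_adjoin ℚ _ (Set.mem_range_self i)⟩

/-- The absolute logarithmic height of a vector: the logarithmic height relative to the number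
field `L` generated by its entries (the sum over all places `v` of `L`, with local degrees, of
`log max_i |x i|_v`), divided by `[L : ℚ]`. -/
def vecHeight {N : ℕ} (x : Fin (N + 1) → QBar) : ℝ :=
  Height.logHeight (coordVec x) / (Module.finrank ℚ (coordField x) : ℝ)

/-- Homogeneous coordinates of `P` of which one is equal to `1`. -/
def normalizedRep {N : ℕ} (P : PN N) : Fin (N + 1) → QBar :=
  fun i => P.rep i / P.rep (Function.ne_iff.mp P.rep_nonzero).choose

/-- The absolute logarithmic Weil height on projective space. The coordinates used generate the
field of definition `ℚ(P)`; by the usual normalization of the places, other coordinates, or a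
larger number field, would give the same value. -/
def weilHeight {N : ℕ} (P : PN N) : ℝ := vecHeight (normalizedRep P)

/-- The polynomials `F 0, …, F N` are homogeneous of degree `d`, have no common zero other than
the origin, and define the self-map `φ` of projective space. -/
def Represents {N : ℕ} (d : ℕ) (F : Fin (N + 1) → MvPolynomial (Fin (N + 1)) QBar)
    (φ : PN N → PN N) : Prop :=
  (∀ i, (F i).IsHomogeneous d) ∧
    ∀ (x : Fin (N + 1) → QBar) (hx : x ≠ 0),
      ∃ hy : (fun i => MvPolynomial.eval x (F i)) ≠ 0,
        φ (Projectivization.mk QBar x hx) =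
          Projectivization.mk QBar (fun i => MvPolynomial.eval x (F i)) hy

/-- An endomorphism (self-morphism) of projective `N`-space over the algebraic numbers. -/
@[ext]
structure ProjEndo (N : ℕ) where
  /-- The action on points. -/
  toFun : PN N → PN N
  /-- The map is given by homogeneous polynomials without common zero. -/
  exists_represents : ∃ d F, Represents d F toFun

namespace ProjEndo

variable {N : ℕ}

instance : CoeFun (ProjEndo N) (fun _ => PN N → PN N) := ⟨ProjEndo.toFun⟩

theorem represents_id : Represents 1 (fun i : Fin (N + 1) => MvPolynomial.X i) id :=
  ⟨fun i => MvPolynomial.isHomogeneous_X _ i,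
    fun x hx => ⟨by simpa using hx, by simp⟩⟩

theorem represents_comp {d e : ℕ} {F G : Fin (N + 1) → MvPolynomial (Fin (N + 1)) QBar}
    {φ ψ : PN N → PN N} (hF : Represents d F φ) (hG : Represents e G ψ) :
    Represents (e * d) (fun i => MvPolynomial.bind₁ G (F i)) (φ ∘ ψ) := by
  refine ⟨fun i => (hF.1 i).aeval G hG.1, fun x hx => ?_⟩
  obtain ⟨hy, h1⟩ := hG.2 x hx
  obtain ⟨hz, h2⟩ := hF.2 _ hy
  have key : (fun i => MvPolynomial.eval x (MvPolynomial.bind₁ G (F i))) =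
      fun i => MvPolynomial.eval (fun j => MvPolynomial.eval x (G j)) (F i) := by
    funext i
    simp only [MvPolynomial.eval, MvPolynomial.eval₂Hom_bind₁]
  refine ⟨by rw [key]; exact hz, ?_⟩
  simp only [Function.comp_apply, h1, h2, key]

/-- Endomorphisms form a monoid, with composition as multiplication. -/
instance : Monoid (ProjEndo N) where
  one := ⟨id, 1, _, represents_id⟩
  mul φ ψ := ⟨φ.toFun ∘ ψ.toFun, by
    obtain ⟨d, F, hF⟩ := φ.exists_represents
    obtain ⟨e, G, hG⟩ := ψ.exists_represents
    exact ⟨e * d, _, represents_comp hF hG⟩⟩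
  mul_assoc _ _ _ := rfl
  one_mul _ := rfl
  mul_one _ := rfl

@[simp] theorem one_apply (P : PN N) : (1 : ProjEndo N) P = P := rfl

@[simp] theorem mul_apply (φ ψ : ProjEndo N) (P : PN N) : (φ * ψ) P = φ (ψ P) := rfl

/-- The degree of an endomorphism: the degree of homogeneous polynomials without common zero that
define it. (For `1 ≤ N` it does not depend on these polynomials, so that the infimum is taken over
a one-element set.) -/
def degree (φ : ProjEndo N) : ℕ := sInf {d | ∃ F, Represents d F φ.toFun}

/-- The endomorphism `φ` can be given by polynomials with coefficients in `K`. -/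
def IsDefinedOver (φ : ProjEndo N) (K : IntermediateField ℚ QBar) : Prop :=
  ∃ (d : ℕ) (F : Fin (N + 1) → MvPolynomial (Fin (N + 1)) K),
    Represents d (fun i => MvPolynomial.map (algebraMap K QBar) (F i)) φ.toFun

/-- The best constant in `h (φ P) = deg φ * h P + O(1)`, as an extended nonnegative real. -/
def heightConst (φ : ProjEndo N) : ENNReal :=
  ⨆ P : PN N, ENNReal.ofReal |weilHeight (φ P) - (φ.degree : ℝ) * weilHeight P|

/-- All sets of endomorphisms are measurable. -/
instance : MeasurableSpace (ProjEndo N) := ⊤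

end ProjEndo

/-- A set of endomorphisms is height controlled if the infimum of the degrees is at least two and
the supremum of the height constants is finite. -/
def HeightControlled {N : ℕ} (S : Set (ProjEndo N)) : Prop :=
  2 ≤ (⨅ φ ∈ S, (φ.degree : ℕ∞)) ∧ (⨆ φ ∈ S, φ.heightConst) < ⊤

/-- Right iteration: for `γ = (θ₁, θ₂, …)`, with `θᵢ = γ (i - 1)`, this is `θ₁ ∘ θ₂ ∘ ⋯ ∘ θₙ`. -/
def rightIter {N : ℕ} {S : Set (ProjEndo N)} (γ : ℕ → S) : ℕ → ProjEndo N
  | 0 => 1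
  | n + 1 => rightIter γ n * (γ n : ProjEndo N)

/-- Left iteration: for `γ = (θ₁, θ₂, …)`, with `θᵢ = γ (i - 1)`, this is `θₙ ∘ ⋯ ∘ θ₂ ∘ θ₁`. -/
def leftIter {N : ℕ} {S : Set (ProjEndo N)} (γ : ℕ → S) : ℕ → ProjEndo N
  | 0 => 1
  | n + 1 => (γ n : ProjEndo N) * leftIter γ n

/-- The right orbit of `P` along the sequence `γ`. -/
def rightOrbit {N : ℕ} {S : Set (ProjEndo N)} (γ : ℕ → S) (P : PN N) : Set (PN N) :=
  Set.range fun n => rightIter γ n P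

/-- The total orbit of `P` under the monoid generated by `S`. -/
def totalOrbit {N : ℕ} (S : Set (ProjEndo N)) (P : PN N) : Set (PN N) :=
  {Q | ∃ f ∈ Submonoid.closure S, Q = f P}

/-- The height-degree quotients along the right orbit, as extended reals. -/
def heightQuotient {N : ℕ} {S : Set (ProjEndo N)} (γ : ℕ → S) (P : PN N) (n : ℕ) : EReal :=
  ((weilHeight (rightIter γ n P) / ((rightIter γ n).degree : ℝ) : ℝ) : EReal)

/-- The product measure on the space of sequences of elements of `S`. -/
def seqMeasure {N : ℕ} {S : Set (ProjEndo N)} (ν : Measure S) : Measure (ℕ → S) :=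
  Measure.infinitePi fun _ : ℕ => ν

/-- `δ` is the dynamical degree of `(S, ν)`: the almost sure common limit of the `n`-th roots of
the degrees of the left and of the right iterates. -/
def IsDynamicalDegree {N : ℕ} {S : Set (ProjEndo N)} (ν : Measure S) (δ : ℝ) : Prop :=
  ∀ᵐ γ ∂(seqMeasure ν),
    Tendsto (fun n : ℕ => ((leftIter γ n).degree : ℝ) ^ (1 / (n : ℝ))) atTop (nhds δ) ∧
    Tendsto (fun n : ℕ => ((rightIter γ n).degree : ℝ) ^ (1 / (n : ℝ))) atTop (nhds δ)

end

/-! Everything rests on one uniform estimate, `abs_weilHeight_rightIter_sub_le`: for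
height-controlled `S` the error in comparing `h(γ_n^+(P))` with `deg(γ_n^+) h(P)` is at most `C
deg(γ_n^+)`, with the same `C` for all `P`, `γ`, `n`. Dividing by the degree gives (1).

For (2) and (3), suppose the total orbit is infinite. It lies over one number field, so Northcott's
theorem provides a word `w` in `S` with `h(w(P)) > C + 1`. Right iteration adds new maps innermost:
if `w` occurs in `γ` just after position `n`, then `γ_{n+m}^+(P) = γ_n^+(w(P))`, whose height is at
least `deg(γ_n^+)` by the uniform estimate. By the second Borel–Cantelli lemma `w` occurs infinitely
often almost surely, so the height is infinitely often at least a fixed positive multiple of the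
degree. Conversely, on a finite right orbit heights are bounded while degrees grow at least like `2
^ n`, so the quotients tend to `0`.

The degree of an iterate is the product of the degrees of its letters, so the strong law of large
numbers for `log deg` gives the dynamical degree; constant factors disappear under `n`-th roots,
which yields the growth of heights. Multiplicativity of the degree needs its independence of the
representing polynomials, which is proved by restriction to a projective line. -/

/-! ### Well-definedness and multiplicativity of the degree -/

/-- A homogeneous polynomial of degree `d` scales by `c ^ d`. -/
theorem MvPolynomial.IsHomogeneous.eval_const_mul {σ R : Type*} [CommSemiring R] {d : ℕ}
    {F : MvPolynomial σ R} (hF : F.IsHomogeneous d) (c : R) (x : σ → R) :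
    MvPolynomial.eval (fun j => c * x j) F = c ^ d * MvPolynomial.eval x F := by
  rw [MvPolynomial.eval_eq, MvPolynomial.eval_eq, Finset.mul_sum]
  refine Finset.sum_congr rfl fun s hs => ?_
  have hs' : ∑ i ∈ s.support, s i = d := by
    have := hF (MvPolynomial.mem_support_iff.mp hs)
    rwa [Pi.one_def, ← Finsupp.degree_eq_weight_one, Finsupp.degree_apply] at this
  simp only [mul_pow, Finset.prod_mul_distrib, Finset.prod_pow_eq_pow_sum, hs']
  ring

/-- Univariate polynomials over an algebraically closed field without a common root generate the
unit ideal. -/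
theorem exists_sum_mul_eq_one_of_no_common_root {k ι : Type*} [Field k] [IsAlgClosed k] [Fintype ι]
    (f : ι → Polynomial k) (hf : ∀ t, ∃ i, (f i).eval t ≠ 0) :
    ∃ a : ι → Polynomial k, ∑ i, a i * f i = 1 := by
  rw [← Ideal.mem_span_range_iff_exists_fun, ← Ideal.eq_top_iff_one]
  obtain ⟨g, hg⟩ := IsPrincipalIdealRing.principal (Ideal.span (Set.range f))
  have hdvd : ∀ i, g ∣ f i := fun i => by
    rw [← Ideal.mem_span_singleton, Ideal.span, ← hg]
    exact Ideal.subset_span (Set.mem_range_self i)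
  rw [hg]
  refine Ideal.span_singleton_eq_top.mpr ?_
  by_contra hu
  -- The case `g = 0` is covered: its degree is `⊥`, not `0`, and every point is a root.
  have : ∃ t, g.IsRoot t := by
    by_cases h0 : g.degree = 0
    · exact absurd (Polynomial.isUnit_iff_degree_eq_zero.mpr h0) hu
    · exact IsAlgClosed.exists_root g h0
  obtain ⟨t, ht⟩ := this
  obtain ⟨i, hi⟩ := hf t
  exact hi (ht.dvd (hdvd i))

namespace Represents

variable {N : ℕ}

/-- Coordinate vectors of the same projective point are proportional, so their two-by-two minors
vanish. -/
theorem eval_mul_eval {d e : ℕ} {F G : Fin (N + 1) → MvPolynomial (Fin (N + 1)) QBar}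
    {φ : PN N → PN N} (hF : Represents d F φ) (hG : Represents e G φ)
    {x : Fin (N + 1) → QBar} (hx : x ≠ 0) (i j : Fin (N + 1)) :
    MvPolynomial.eval x (F i) * MvPolynomial.eval x (G j) =
      MvPolynomial.eval x (F j) * MvPolynomial.eval x (G i) := by
  obtain ⟨h1, h2⟩ := hF.2 x hx
  obtain ⟨h3, h4⟩ := hG.2 x hx
  rw [h2] at h4
  obtain ⟨a, ha⟩ := (Projectivization.mk_eq_mk_iff' _ _ _ _ _).mp h4
  have hi := congrFun ha i
  have hj := congrFun ha j
  simp only [Pi.smul_apply, smul_eq_mul] at hi hj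
  rw [← hi, ← hj]
  ring

theorem exists_eval_ne_zero {d : ℕ} {F : Fin (N + 1) → MvPolynomial (Fin (N + 1)) QBar}
    {φ : PN N → PN N} (hF : Represents d F φ) {x : Fin (N + 1) → QBar} (hx : x ≠ 0) :
    ∃ i, MvPolynomial.eval x (F i) ≠ 0 :=
  Function.ne_iff.mp (hF.2 x hx).1

/-- The affine line through the last basis vector in the direction of the zeroth one. -/
noncomputable def line (N : ℕ) (i : Fin (N + 1)) : Polynomial QBar :=
  if i = 0 then Polynomial.X else if i = Fin.last N then 1 else 0

theorem eval_aeval_line (F : MvPolynomial (Fin (N + 1)) QBar) (t : QBar) :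
    (MvPolynomial.aeval (line N) F).eval t =
      MvPolynomial.eval (fun i => (line N i).eval t) F := by
  rw [← Polynomial.coe_evalRingHom, MvPolynomial.aeval_def, MvPolynomial.hom_eval₂,
    MvPolynomial.eval, MvPolynomial.coe_eval₂Hom]
  congr 1
  ext x
  simp

/-- With `1 ≤ N` the zeroth and last indices are distinct, so the last coordinate is constantly `1`;
for `N = 0` the line would pass through the origin. -/
theorem eval_line_ne_zero (hN : 1 ≤ N) (t : QBar) : (fun i => (line N i).eval t) ≠ 0 := by
  refine Function.ne_iff.mpr ⟨Fin.last N, ?_⟩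
  have : Fin.last N ≠ 0 := by simp [Fin.ext_iff]; omega
  simp [line, this]

/-- Two representations of the same map differ, along a line, by a constant factor. -/
theorem exists_eval_line_eq (hN : 1 ≤ N) {d e : ℕ}
    {F G : Fin (N + 1) → MvPolynomial (Fin (N + 1)) QBar}
    {φ : PN N → PN N} (hF : Represents d F φ) (hG : Represents e G φ) :
    ∃ c : QBar, c ≠ 0 ∧ ∀ j t, MvPolynomial.eval (fun i => (line N i).eval t) (G j) =
      c * MvPolynomial.eval (fun i => (line N i).eval t) (F j) := by
  set f := fun i => MvPolynomial.aeval (line N) (F i) with hf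
  set g := fun i => MvPolynomial.aeval (line N) (G i) with hg
  have hfg : ∀ i j, f i * g j = f j * g i := fun i j => Polynomial.funext fun t => by
    simp only [hf, hg, Polynomial.eval_mul, eval_aeval_line]
    exact eval_mul_eval hF hG (eval_line_ne_zero hN t) i j
  obtain ⟨a, ha⟩ := exists_sum_mul_eq_one_of_no_common_root f fun t => by
    simp only [hf, eval_aeval_line]
    exact exists_eval_ne_zero hF (eval_line_ne_zero hN t)
  obtain ⟨b, hb⟩ := exists_sum_mul_eq_one_of_no_common_root g fun t => by
    simp only [hg, eval_aeval_line]
    exact exists_eval_ne_zero hG (eval_line_ne_zero hN t)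
  -- The Bézout relation for `f` turns vanishing minors into a polynomial proportionality factor `∑
  -- a i * g i`; the relation for `g` then makes this factor a unit, hence a constant.
  have hgu : ∀ j, g j = (∑ i, a i * g i) * f j := fun j => by
    calc g j = (∑ i, a i * f i) * g j := by rw [ha, one_mul]
      _ = (∑ i, a i * g i) * f j := by
        rw [Finset.sum_mul, Finset.sum_mul]
        exact Finset.sum_congr rfl fun i _ => by rw [mul_assoc, hfg i j]; ring
  have hu : IsUnit (∑ i, a i * g i) := by
    refine IsUnit.of_mul_eq_one (∑ j, b j * f j) ?_
    rw [← hb, Finset.mul_sum]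
    exact Finset.sum_congr rfl fun j _ => by rw [hgu j]; ring
  obtain ⟨c, hc, hcu⟩ := Polynomial.isUnit_iff.mp hu
  refine ⟨c, hc.ne_zero, fun j t => ?_⟩
  have := congrArg (Polynomial.eval t) (hgu j)
  rwa [← hcu, Polynomial.eval_mul, Polynomial.eval_C, eval_aeval_line, eval_aeval_line] at this

/-- In the chart of the line around its point at infinity, `G` equals `F` times a constant and `r ^
(e - d)`. If `d < e`, all the `G j` would vanish at `r = 0`, a nonzero vector. -/
theorem degree_le (hN : 1 ≤ N) {d e : ℕ}
    {F G : Fin (N + 1) → MvPolynomial (Fin (N + 1)) QBar}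
    {φ : PN N → PN N} (hF : Represents d F φ) (hG : Represents e G φ) : e ≤ d := by
  by_contra! hlt
  obtain ⟨c, hc, hcG⟩ := exists_eval_line_eq hN hF hG
  set rev : Fin (N + 1) → Polynomial QBar := fun i =>
    if i = 0 then 1 else if i = Fin.last N then Polynomial.X else 0 with hrev
  have hrevaeval : ∀ (H : MvPolynomial (Fin (N + 1)) QBar) (r : QBar),
      (MvPolynomial.aeval rev H).eval r = MvPolynomial.eval (fun i => (rev i).eval r) H := by
    intro H r
    rw [← Polynomial.coe_evalRingHom, MvPolynomial.aeval_def, MvPolynomial.hom_eval₂,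
      MvPolynomial.eval, MvPolynomial.coe_eval₂Hom]
    congr 1
    ext x
    simp
  have hscale : ∀ r : QBar, r ≠ 0 →
      (fun i => (rev i).eval r) = fun i => r * (line N i).eval r⁻¹ := by
    intro r hr
    funext i
    simp only [hrev, line]
    split_ifs <;> simp [hr]
  have hpoly : ∀ j, MvPolynomial.aeval rev (G j) =
      Polynomial.C c * Polynomial.X ^ (e - d) * MvPolynomial.aeval rev (F j) := by
    intro j
    refine Polynomial.eq_of_infinite_eval_eq _ _ ((Set.finite_singleton (0 : QBar)).infinite_compl.mono ?_)
    intro r hr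
    have hr : r ≠ 0 := hr
    simp only [Set.mem_ofPred_eq, Polynomial.eval_mul, Polynomial.eval_C, Polynomial.eval_pow,
      Polynomial.eval_X, hrevaeval, hscale r hr]
    rw [(hG.1 j).eval_const_mul, (hF.1 j).eval_const_mul, hcG j]
    rw [show r ^ e = r ^ (e - d) * r ^ d by rw [← pow_add]; congr 1; omega]
    ring
  obtain ⟨j, hj⟩ := exists_eval_ne_zero hG (x := fun i => (rev i).eval 0)
    (Function.ne_iff.mpr ⟨0, by simp [hrev]⟩)
  apply hj
  rw [← hrevaeval, hpoly]
  simp [show e - d ≠ 0 by omega]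

theorem degree_unique (hN : 1 ≤ N) {d e : ℕ}
    {F G : Fin (N + 1) → MvPolynomial (Fin (N + 1)) QBar}
    {φ : PN N → PN N} (hF : Represents d F φ) (hG : Represents e G φ) : d = e :=
  le_antisymm (degree_le hN hG hF) (degree_le hN hF hG)

end Represents

namespace ProjEndo

variable {N : ℕ}

/-- The infimum defining `degree` is attained, so uniqueness lets any representation compute it. -/
theorem degree_eq (hN : 1 ≤ N) {φ : ProjEndo N} {d : ℕ}
    {F : Fin (N + 1) → MvPolynomial (Fin (N + 1)) QBar} (hF : Represents d F φ.toFun) :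
    φ.degree = d := by
  obtain ⟨G, hG⟩ := Nat.sInf_mem (s := {d | ∃ F, Represents d F φ.toFun}) ⟨d, F, hF⟩
  exact Represents.degree_unique hN hG hF

theorem degree_one (hN : 1 ≤ N) : (1 : ProjEndo N).degree = 1 :=
  degree_eq hN represents_id

theorem degree_mul (hN : 1 ≤ N) (φ ψ : ProjEndo N) :
    (φ * ψ).degree = φ.degree * ψ.degree := by
  obtain ⟨d, F, hF⟩ := φ.exists_represents
  obtain ⟨e, G, hG⟩ := ψ.exists_represents
  rw [degree_eq hN hF, degree_eq hN hG, mul_comm]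
  exact degree_eq hN (φ := φ * ψ) (represents_comp (φ := φ.toFun) hF hG)

end ProjEndo

/-! ### Northcott finiteness and fields of definition -/

/-- A number field inside `QBar` has only finitely many subfields. -/
theorem finite_setOf_intermediateField_le (L : IntermediateField ℚ QBar) [FiniteDimensional ℚ L] :
    {M : IntermediateField ℚ QBar | M ≤ L}.Finite := by
  have : Finite (IntermediateField ℚ L) :=
    Field.finite_intermediateField_of_exists_primitive_element ℚ L
      (Field.exists_primitive_element ℚ L)
  refine (Set.finite_range fun M : IntermediateField ℚ L => IntermediateField.lift M).subset ?_
  intro M hM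
  exact ⟨IntermediateField.restrict hM, IntermediateField.lift_restrict hM⟩

/-- Northcott's theorem for vectors with a coordinate equal to `1` over a number field. -/
theorem finite_setOf_logHeight_le {M ι : Type*} [Field M] [NumberField M] [Finite ι] (B : ℝ) :
    {y : ι → M | (∃ i, y i = 1) ∧ Height.logHeight y ≤ B}.Finite := by
  refine (Set.Finite.pi' fun _ : ι => NumberField.finite_setOfPred_logHeight₁_le (K := M) B).subset ?_
  rintro y ⟨⟨i, hi⟩, hy⟩ j
  refine le_trans ?_ hy
  -- As `y i = 1`, the pair defining the height of the number `y j` is a subfamily of `y`, so its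
  -- height is at most that of `y`.
  have : ![y j, 1] = y ∘ ![j, i] := by
    funext k
    fin_cases k <;> simp [hi]
  rw [Height.logHeight₁_eq_logHeight, this]
  exact Height.logHeight_comp_le _ _

variable {N : ℕ}

theorem normalizedRep_eq_one (P : PN N) : ∃ i, normalizedRep P i = 1 :=
  ⟨(Function.ne_iff.mp P.rep_nonzero).choose,
    div_self (Function.ne_iff.mp P.rep_nonzero).choose_spec⟩

theorem normalizedRep_ne_zero (P : PN N) : normalizedRep P ≠ 0 := by
  obtain ⟨i, hi⟩ := normalizedRep_eq_one P
  exact Function.ne_iff.mpr ⟨i, by simp [hi]⟩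

theorem mk_normalizedRep (P : PN N) :
    Projectivization.mk QBar (normalizedRep P) (normalizedRep_ne_zero P) = P := by
  conv_rhs => rw [← P.mk_rep]
  rw [Projectivization.mk_eq_mk_iff']
  refine ⟨(P.rep (Function.ne_iff.mp P.rep_nonzero).choose)⁻¹, ?_⟩
  funext i
  simp [normalizedRep, div_eq_inv_mul]

/-- The normalized coordinates of a point that has some coordinates in `L` are in `L`. -/
theorem normalizedRep_mk_mem (L : IntermediateField ℚ QBar) {y : Fin (N + 1) → QBar} (hy : y ≠ 0)
    (hL : ∀ i, y i ∈ L) (i : Fin (N + 1)) : normalizedRep (Projectivization.mk QBar y hy) i ∈ L := by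
  obtain ⟨a, ha⟩ := Projectivization.exists_smul_eq_mk_rep QBar y hy
  -- The unknown scalar relating `y` to the chosen representative cancels in the quotient.
  have : normalizedRep (Projectivization.mk QBar y hy) i =
      y i / y (Function.ne_iff.mp (Projectivization.mk QBar y hy).rep_nonzero).choose := by
    unfold normalizedRep
    simp only [← ha, Pi.smul_apply, Units.smul_def, smul_eq_mul]
    exact mul_div_mul_left _ _ a.ne_zero
  rw [this]
  exact div_mem (hL _) (hL _)

theorem weilHeight_nonneg (P : PN N) : 0 ≤ weilHeight P :=
  div_nonneg (Height.logHeight_nonneg _) (Nat.cast_nonneg _)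

/-- Fixing the generated field `M` turns the absolute height into a height relative to `M`, where
Northcott applies with the bound `B * [M : ℚ]`. -/
theorem finite_setOf_vecHeight_le (M : IntermediateField ℚ QBar) (B : ℝ) :
    {x : Fin (N + 1) → QBar | coordField x = M ∧ (∃ i, x i = 1) ∧ vecHeight x ≤ B}.Finite := by
  by_cases hM : ∃ x : Fin (N + 1) → QBar, coordField x = M
  · obtain ⟨x₀, rfl⟩ := hM
    refine ((finite_setOf_logHeight_le (M := coordField x₀) (ι := Fin (N + 1))
      (B * Module.finrank ℚ (coordField x₀))).image fun y i => (y i : QBar)).subset ?_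
    rintro x ⟨hx, ⟨i, hi⟩, hB⟩
    have hpos : 0 < (Module.finrank ℚ (coordField x) : ℝ) := by
      exact_mod_cast Module.finrank_pos
    unfold vecHeight at hB
    rw [div_le_iff₀ hpos] at hB
    have key : coordVec x ∈ {y : Fin (N + 1) → coordField x | (∃ i, y i = 1) ∧
        Height.logHeight y ≤ B * Module.finrank ℚ (coordField x)} :=
      ⟨⟨i, Subtype.ext hi⟩, hB⟩
    have mem_image : x ∈ (fun (y : Fin (N + 1) → coordField x) i => (y i : QBar)) ''
        {y : Fin (N + 1) → coordField x | (∃ i, y i = 1) ∧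
        Height.logHeight y ≤ B * Module.finrank ℚ (coordField x)} := ⟨_, key, rfl⟩
    -- The height depends on the field as a type, so the equality of fields is substituted only
    -- after both fields are generalized to variables.
    have transport : ∀ (A : IntermediateField ℚ QBar) [NumberField A] (A' : IntermediateField ℚ QBar)
        [NumberField A'], A = A' →
        x ∈ (fun (y : Fin (N + 1) → A) i => (y i : QBar)) ''
        {y : Fin (N + 1) → A | (∃ i, y i = 1) ∧
          Height.logHeight y ≤ B * Module.finrank ℚ A} →
        x ∈ (fun (y : Fin (N + 1) → A') i => (y i : QBar)) ''
        {y : Fin (N + 1) → A' | (∃ i, y i = 1) ∧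
          Height.logHeight y ≤ B * Module.finrank ℚ A'} := by
      rintro A _ A' _ rfl h
      exact h
    exact transport _ _ hx mem_image
  · convert Set.finite_empty
    ext x
    simp only [Set.mem_ofPred_eq, Set.mem_empty_iff_false, iff_false]
    exact fun h => hM ⟨x, h.1⟩

/-- Northcott's theorem for the points over a fixed number field. -/
theorem finite_setOf_weilHeight_le (L : IntermediateField ℚ QBar) [FiniteDimensional ℚ L] (B : ℝ) :
    {P : PN N | (∀ i, normalizedRep P i ∈ L) ∧ weilHeight P ≤ B}.Finite := by
  have hinj : Function.Injective (normalizedRep : PN N → _) := by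
    intro P Q h
    rw [← mk_normalizedRep P, ← mk_normalizedRep Q]
    congr 1
  refine (((finite_setOf_intermediateField_le L).biUnion fun M _ =>
    finite_setOf_vecHeight_le (N := N) M B).preimage hinj.injOn).subset ?_
  rintro P ⟨hL, hB⟩
  simp only [Set.mem_preimage, Set.mem_iUnion]
  refine ⟨coordField (normalizedRep P), ?_, rfl, normalizedRep_eq_one P, hB⟩
  refine IntermediateField.adjoin_le_iff.mpr ?_
  rintro _ ⟨i, rfl⟩
  exact hL i

/-- Polynomials over `K` take values in `L` at coordinates in `L`, and normalization only divides by
one of these values. This keeps total orbits over one number field. -/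
theorem ProjEndo.IsDefinedOver.normalizedRep_mem {K L : IntermediateField ℚ QBar} (hKL : K ≤ L)
    {φ : ProjEndo N} (hφ : φ.IsDefinedOver K) {P : PN N} (hP : ∀ i, normalizedRep P i ∈ L)
    (i : Fin (N + 1)) : normalizedRep (φ P) i ∈ L := by
  obtain ⟨d, F, hF⟩ := hφ
  obtain ⟨hy, h⟩ := hF.2 _ (normalizedRep_ne_zero P)
  rw [mk_normalizedRep] at h
  rw [h]
  refine normalizedRep_mk_mem L hy (fun j => ?_) i
  rw [MvPolynomial.eval_map, MvPolynomial.eval₂_eq]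
  exact sum_mem fun s _ => mul_mem (hKL ((F j).coeff s).2)
    (prod_mem fun k _ => pow_mem (hP k) _)

/-- If the total orbit of `P` is infinite, it has points of arbitrarily large height. -/
theorem exists_lt_weilHeight_of_infinite {S : Set (ProjEndo N)} (K : IntermediateField ℚ QBar)
    [FiniteDimensional ℚ K] (hSK : ∀ φ ∈ S, φ.IsDefinedOver K) {P : PN N}
    (hP : (totalOrbit S P).Infinite) (B : ℝ) :
    ∃ f ∈ Submonoid.closure S, B < weilHeight (f P) := by
  by_contra! hB
  refine hP ((finite_setOf_weilHeight_le (K ⊔ coordField (normalizedRep P)) B).subset ?_)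
  rintro _ ⟨f, hf, rfl⟩
  refine ⟨?_, hB f hf⟩
  clear hB
  induction hf using Submonoid.closure_induction_left with
  | one =>
    exact fun i => le_sup_right (a := K) (coordVec (normalizedRep P) i).2
  | mul_left φ hφ f hf ih =>
    exact (hSK φ hφ).normalizedRep_mem le_sup_left ih

/-! ### Independent samples: recurrence of words and the law of large numbers -/

/-- Almost every sequence of independent samples contains a given word of atoms infinitely often. -/
theorem ae_frequently_block_eq {α : Type*} [MeasurableSpace α] [MeasurableSingletonClass α]
    (ν : Measure α) [IsProbabilityMeasure ν] (hν : ∀ a, 0 < ν {a}) (m : ℕ) (w : ℕ → α) :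
    ∀ᵐ γ ∂(Measure.infinitePi fun _ : ℕ => ν), ∃ᶠ n in atTop, ∀ i < m, γ (n + i) = w i := by
  -- Blocks of length `m + 1` rather than `m` are never empty, so block `k` starts at or beyond `k`
  -- even for the empty word; the extra letter `w m` is harmless.
  set M := m + 1 with hM
  set I : ℕ → Finset ℕ := fun k => Finset.Ico (k * M) (k * M + M) with hI
  set t : ℕ → Set α := fun i => {w (i % M)} with ht
  set A : ℕ → Set (ℕ → α) := fun k => Set.pi (I k) t with hA
  have hmeas : ∀ k, MeasurableSet (A k) := fun k =>
    MeasurableSet.pi (Finset.countable_toSet _) fun i _ => measurableSet_singleton _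
  have hdisj : ∀ s : Finset ℕ, (s : Set ℕ).PairwiseDisjoint I := by
    intro s k _ l _ hkl
    refine Finset.disjoint_left.mpr fun i hk hl => hkl ?_
    simp only [hI, Finset.mem_Ico] at hk hl
    have h1 : i / M = k := Nat.div_eq_of_lt_le hk.1 (by rw [add_mul, one_mul]; exact hk.2)
    have h2 : i / M = l := Nat.div_eq_of_lt_le hl.1 (by rw [add_mul, one_mul]; exact hl.2)
    exact h1.symm.trans h2
  have hmA : ∀ k, Measure.infinitePi (fun _ : ℕ => ν) (A k) = ∏ i ∈ I k, ν (t i) := fun k =>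
    Measure.infinitePi_pi (fun _ : ℕ => ν) fun i _ => measurableSet_singleton _
  have hindep : ProbabilityTheory.iIndepSet A (Measure.infinitePi fun _ : ℕ => ν) := by
    rw [ProbabilityTheory.iIndepSet_iff_meas_biInter hmeas]
    intro s
    have : ⋂ k ∈ s, A k = Set.pi (s.biUnion I : Finset ℕ) t := by
      ext γ
      simp only [hA, Set.mem_iInter, Set.mem_pi, Finset.mem_coe, Finset.mem_biUnion]
      exact ⟨fun h i ⟨k, hk, hi⟩ => h k hk i hi, fun h k hk i hi => h i ⟨k, hk, hi⟩⟩
    rw [this, Measure.infinitePi_pi (fun _ : ℕ => ν) fun i _ => measurableSet_singleton _,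
      Finset.prod_biUnion (hdisj s)]
    exact Finset.prod_congr rfl fun k _ => (hmA k).symm
  have hconst : ∀ k, ∏ i ∈ I k, ν (t i) = ∏ j ∈ Finset.range M, ν {w j} := by
    intro k
    simp only [hI]
    rw [Finset.prod_Ico_eq_prod_range, Nat.add_sub_cancel_left]
    refine Finset.prod_congr rfl fun j hj => ?_
    simp only [ht]
    rw [Nat.mul_add_mod', Nat.mod_eq_of_lt (Finset.mem_range.mp hj)]
  have hne : ∏ j ∈ Finset.range M, ν {w j} ≠ 0 := Finset.prod_ne_zero_iff.mpr fun j _ => (hν _).ne'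
  -- All block events have the same positive probability, so the sum diverges and the second
  -- Borel–Cantelli lemma applies to these independent events.
  have hsum : ∑' k, Measure.infinitePi (fun _ : ℕ => ν) (A k) = ⊤ := by
    simp only [hmA, hconst]
    exact ENNReal.tsum_const_eq_top_of_ne_zero hne
  have h1 := ProbabilityTheory.measure_limsup_eq_one hmeas hindep hsum
  have h2 := (mem_ae_iff_prob_eq_one (MeasurableSet.measurableSet_limsup hmeas)).mpr h1
  filter_upwards [h2] with γ hγ
  rw [Filter.mem_limsup_iff_frequently_mem, frequently_atTop] at hγ
  refine frequently_atTop.mpr fun a => ?_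
  obtain ⟨k, hk, hγk⟩ := hγ a
  refine ⟨k * M, hk.trans (Nat.le_mul_of_pos_right k m.succ_pos), fun i hi => ?_⟩
  have hiM : i < M := by omega
  have := hγk (k * M + i) (by simp [hI, hiM])
  simp only [ht, Set.mem_singleton_iff] at this
  rwa [Nat.mul_add_mod', Nat.mod_eq_of_lt hiM] at this

/-- The strong law of large numbers for a function of the coordinates of a product space. -/
theorem ae_tendsto_sum_div {α : Type*} [MeasurableSpace α]
    (ν : Measure α) [IsProbabilityMeasure ν] {f : α → ℝ} (hf : Measurable f)
    (hint : Integrable f ν) :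
    ∀ᵐ γ ∂(Measure.infinitePi fun _ : ℕ => ν),
      Tendsto (fun n : ℕ => (∑ i ∈ Finset.range n, f (γ i)) / n) atTop (nhds (∫ a, f a ∂ν)) := by
  have hmp : ∀ i, MeasurePreserving (fun γ : ℕ → α => γ i)
      (Measure.infinitePi fun _ : ℕ => ν) ν := fun i =>
    ⟨measurable_pi_apply i, Measure.infinitePi_map_eval (fun _ : ℕ => ν) i⟩
  have hid : ∀ i, ProbabilityTheory.IdentDistrib (fun γ : ℕ → α => f (γ i)) f
      (Measure.infinitePi fun _ : ℕ => ν) ν := fun i =>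
    { aemeasurable_fst := (hf.comp (measurable_pi_apply i)).aemeasurable
      aemeasurable_snd := hf.aemeasurable
      map_eq := by
        conv_rhs => rw [← (hmp i).map_eq, Measure.map_map hf (measurable_pi_apply i)]
        rfl }
  have h := ProbabilityTheory.strong_law_ae_real (fun i (γ : ℕ → α) => f (γ i))
    ((hmp 0).integrable_comp_of_integrable hint)
    (fun i j hij => (ProbabilityTheory.iIndepFun_infinitePi (X := fun _ => f)
      (fun _ => hf)).indepFun hij)
    (fun i => (hid i).trans (hid 0).symm)
  have hE : ∫ γ, f (γ 0) ∂(Measure.infinitePi fun _ : ℕ => ν) = ∫ a, f a ∂ν :=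
    (hid 0).integral_eq
  rwa [hE] at h

/-! ### Limits of `n`-th roots -/

/-- The upper limit of `n`-th roots of a sequence comparable infinitely often to `D`. -/
theorem limsup_rpow_one_div_eq {h D : ℕ → ℝ} {δ c c' : ℝ} (hc : 0 < c) (hc' : 0 < c')
    (hD : ∀ n, 0 ≤ D n) (h0 : ∀ n, 0 ≤ h n)
    (hδ : Tendsto (fun n : ℕ => D n ^ (1 / (n : ℝ))) atTop (nhds δ))
    (hle : ∀ n, h n ≤ c' * D n) (hge : ∃ᶠ n in atTop, c * D n ≤ h n) :
    limsup (fun n : ℕ => ((h n ^ (1 / (n : ℝ)) : ℝ) : EReal)) atTop = (δ : EReal) := by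
  -- A positive constant factor is invisible in the limit because `b ^ (1 / n)` tends to `1`.
  have hroot : ∀ b : ℝ, 0 < b →
      Tendsto (fun n : ℕ => (((b * D n) ^ (1 / (n : ℝ)) : ℝ) : EReal)) atTop (nhds (δ : EReal)) := by
    intro b hb
    have hb1 : Tendsto (fun n : ℕ => b ^ (1 / (n : ℝ))) atTop (nhds 1) := by
      have := (Real.continuousAt_const_rpow hb.ne').tendsto.comp
        (tendsto_one_div_atTop_nhds_zero_nat (𝕜 := ℝ))
      rwa [Real.rpow_zero] at this
    have := (continuous_coe_real_ereal.tendsto _).comp (hb1.mul hδ)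
    rw [one_mul] at this
    refine this.congr fun n => ?_
    simp only [Function.comp_apply]
    rw [Real.mul_rpow hb.le (hD n)]
  refine le_antisymm ?_ ?_
  · rw [← (hroot c' hc').limsup_eq]
    refine limsup_le_limsup (Eventually.of_forall fun n => ?_)
    exact EReal.coe_le_coe_iff.mpr (Real.rpow_le_rpow (h0 n) (hle n) (by positivity))
  · refine le_of_forall_lt fun a ha => ?_
    obtain ⟨b, hab, hbδ⟩ := exists_between ha
    refine hab.trans_le (le_limsup_of_frequently_le ?_ (by isBoundedDefault))
    refine (hge.and_eventually ((hroot c hc).eventually_const_lt hbδ)).mono ?_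
    rintro n ⟨h1, h2⟩
    exact h2.le.trans (EReal.coe_le_coe_iff.mpr
      (Real.rpow_le_rpow (mul_nonneg hc.le (hD n)) h1 (by positivity)))

/-- The `n`-th roots of products converge to the exponential of the limit of averaged
logarithms. -/
theorem tendsto_prod_rpow_one_div {d : ℕ → ℝ} {e : ℝ} (hd : ∀ n, 0 < d n)
    (h : Tendsto (fun n : ℕ => (∑ i ∈ Finset.range n, Real.log (d i)) / n) atTop (nhds e)) :
    Tendsto (fun n : ℕ => (∏ i ∈ Finset.range n, d i) ^ (1 / (n : ℝ))) atTop
      (nhds (Real.exp e)) := by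
  refine ((Real.continuous_exp.tendsto e).comp h).congr fun n => ?_
  rw [Function.comp_apply, Real.rpow_def_of_pos (Finset.prod_pos fun i _ => hd i),
    Real.log_prod fun i _ => (hd i).ne', mul_one_div]

/-! ### Iterates of height-controlled sets and the uniform height estimate -/

variable {S : Set (ProjEndo N)}

namespace HeightControlled

theorem two_le_degree (hS : HeightControlled S) (φ : S) : 2 ≤ (φ : ProjEndo N).degree := by
  have := le_iInf₂_iff.mp hS.1 φ φ.2
  exact_mod_cast this

/-- The supremum of the height constants is finite, so passing to `toReal` keeps it an upper bound.
-/
theorem exists_bound (hS : HeightControlled S) : ∃ C : ℝ, 0 ≤ C ∧ ∀ (φ : S) (P : PN N),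
    |weilHeight ((φ : ProjEndo N) P) - ((φ : ProjEndo N).degree : ℝ) * weilHeight P| ≤ C := by
  refine ⟨(⨆ φ ∈ S, φ.heightConst).toReal, ENNReal.toReal_nonneg, fun φ P => ?_⟩
  rw [← ENNReal.ofReal_le_iff_le_toReal hS.2.ne]
  exact (le_iSup (fun P : PN N => ENNReal.ofReal |weilHeight ((φ : ProjEndo N) P) -
    ((φ : ProjEndo N).degree : ℝ) * weilHeight P|) P).trans
    (le_iSup₂ (f := fun (φ : ProjEndo N) (_ : φ ∈ S) => φ.heightConst) φ.1 φ.2)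

end HeightControlled

theorem degree_rightIter (hN : 1 ≤ N) (γ : ℕ → S) (n : ℕ) :
    (rightIter γ n).degree = ∏ i ∈ Finset.range n, (γ i : ProjEndo N).degree := by
  induction n with
  | zero => exact ProjEndo.degree_one hN
  | succ n ih => rw [rightIter, ProjEndo.degree_mul hN, ih, Finset.prod_range_succ]

theorem degree_leftIter (hN : 1 ≤ N) (γ : ℕ → S) (n : ℕ) :
    (leftIter γ n).degree = ∏ i ∈ Finset.range n, (γ i : ProjEndo N).degree := by
  induction n with
  | zero => exact ProjEndo.degree_one hN
  | succ n ih => rw [leftIter, ProjEndo.degree_mul hN, ih, Finset.prod_range_succ, mul_comm]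

theorem two_pow_le_degree_rightIter (hN : 1 ≤ N) (hS : HeightControlled S) (γ : ℕ → S) (n : ℕ) :
    2 ^ n ≤ (rightIter γ n).degree := by
  rw [degree_rightIter hN]
  simpa using Finset.pow_card_le_prod (Finset.range n) (fun i => (γ i : ProjEndo N).degree) 2
    fun i _ => hS.two_le_degree (γ i)

theorem degree_rightIter_pos (hN : 1 ≤ N) (hS : HeightControlled S) (γ : ℕ → S) (n : ℕ) :
    (0 : ℝ) < (rightIter γ n).degree := by
  have := two_pow_le_degree_rightIter hN hS γ n
  exact_mod_cast (pow_pos two_pos n).trans_le this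

theorem rightIter_mem_closure (γ : ℕ → S) (n : ℕ) :
    rightIter γ n ∈ Submonoid.closure S := by
  induction n with
  | zero => exact one_mem _
  | succ n ih => exact mul_mem ih (Submonoid.subset_closure (γ n).2)

theorem rightOrbit_subset_totalOrbit (γ : ℕ → S) (P : PN N) :
    rightOrbit γ P ⊆ totalOrbit S P := by
  rintro _ ⟨n, rfl⟩
  exact ⟨_, rightIter_mem_closure γ n, rfl⟩

theorem rightIter_congr {γ γ' : ℕ → S} {n : ℕ} (h : ∀ i < n, γ i = γ' i) :
    rightIter γ n = rightIter γ' n := by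
  induction n with
  | zero => rfl
  | succ n ih =>
    rw [rightIter, rightIter, ih fun i hi => h i (hi.trans n.lt_succ_self), h n n.lt_succ_self]

/-- Later letters act first: a word that occurs far out in `γ` is applied directly to the point. -/
theorem rightIter_add (γ : ℕ → S) (n m : ℕ) :
    rightIter γ (n + m) = rightIter γ n * rightIter (fun i => γ (n + i)) m := by
  induction m with
  | zero => exact (mul_one _).symm
  | succ m ih => rw [← add_assoc, rightIter, ih, rightIter, mul_assoc]

/-- Every element of the monoid generated by `S` is the value of a finite word. -/
theorem exists_rightIter_eq [Nonempty S] {f : ProjEndo N} (hf : f ∈ Submonoid.closure S) :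
    ∃ (m : ℕ) (w : ℕ → S), f = rightIter w m := by
  induction hf using Submonoid.closure_induction_right with
  | one => exact ⟨0, fun _ => Classical.arbitrary S, rfl⟩
  | mul_right f hf φ hφ ih =>
    obtain ⟨m, w, rfl⟩ := ih
    refine ⟨m + 1, Function.update w m ⟨φ, hφ⟩, ?_⟩
    rw [rightIter, Function.update_self]
    congr 1
    exact rightIter_congr fun i hi => (Function.update_of_ne hi.ne _ _).symm

/-- The height grows along right iterates like the degree, up to an error bounded by a constant
times the degree. -/
theorem abs_weilHeight_rightIter_sub_le (hN : 1 ≤ N) (hS : HeightControlled S) {C : ℝ}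
    (hC0 : 0 ≤ C) (hC : ∀ (φ : S) (P : PN N),
      |weilHeight ((φ : ProjEndo N) P) - ((φ : ProjEndo N).degree : ℝ) * weilHeight P| ≤ C)
    (γ : ℕ → S) (n : ℕ) (P : PN N) :
    |weilHeight (rightIter γ n P) - (rightIter γ n).degree * weilHeight P| ≤
      C * (rightIter γ n).degree := by
  -- The new map acts innermost, so the induction hypothesis is needed at the point `γ n P`.
  induction n generalizing P with
  | zero =>
    simp [rightIter, ProjEndo.degree_one hN, hC0]
  | succ n ih =>
    have h1 := ih ((γ n : ProjEndo N) P)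
    have h2 := hC (γ n) P
    have hD : (0 : ℝ) ≤ (rightIter γ n).degree := Nat.cast_nonneg _
    have hd : (2 : ℝ) ≤ (γ n : ProjEndo N).degree := by exact_mod_cast hS.two_le_degree (γ n)
    rw [rightIter, ProjEndo.mul_apply, ProjEndo.degree_mul hN, Nat.cast_mul]
    set D : ℝ := ((rightIter γ n).degree : ℝ)
    set d : ℝ := ((γ n : ProjEndo N).degree : ℝ)
    calc |weilHeight (rightIter γ n ((γ n : ProjEndo N) P)) - D * d * weilHeight P|
        = |(weilHeight (rightIter γ n ((γ n : ProjEndo N) P)) -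
            D * weilHeight ((γ n : ProjEndo N) P)) +
            D * (weilHeight ((γ n : ProjEndo N) P) - d * weilHeight P)| := by ring_nf
      _ ≤ C * D + D * C := by
        refine (abs_add_le _ _).trans (add_le_add h1 ?_)
        rw [abs_mul, abs_of_nonneg hD]
        exact mul_le_mul_of_nonneg_left h2 hD
      _ = C * D * 2 := by ring
      -- Degree at least two absorbs the doubled error, so the constant `C` does not grow with `n`.
      _ ≤ C * D * d := mul_le_mul_of_nonneg_left hd (mul_nonneg hC0 hD)
      _ = C * (D * d) := by ring

theorem abs_weilHeight_div_degree_sub_le (hN : 1 ≤ N) (hS : HeightControlled S) {C : ℝ}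
    (hC0 : 0 ≤ C) (hC : ∀ (φ : S) (P : PN N),
      |weilHeight ((φ : ProjEndo N) P) - ((φ : ProjEndo N).degree : ℝ) * weilHeight P| ≤ C)
    (γ : ℕ → S) (n : ℕ) (P : PN N) :
    |weilHeight (rightIter γ n P) / (rightIter γ n).degree - weilHeight P| ≤ C := by
  have hD := degree_rightIter_pos hN hS γ n
  rw [div_sub' hD.ne', abs_div, abs_of_pos hD, div_le_iff₀ hD]
  exact abs_weilHeight_rightIter_sub_le hN hS hC0 hC γ n P

/-- A sequence of reals within `C` of `a` has its upper and lower limits within `C` of `a`. -/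
theorem exists_liminf_limsup_eq {q : ℕ → ℝ} {a C : ℝ} (hq : ∀ n, |q n - a| ≤ C) :
    ∃ l u : ℝ, liminf (fun n => (q n : EReal)) atTop = (l : EReal) ∧
      limsup (fun n => (q n : EReal)) atTop = (u : EReal) ∧ |l - a| ≤ C ∧ |u - a| ≤ C := by
  have h1 : ∀ n, ((a - C : ℝ) : EReal) ≤ q n := fun n => by
    have := abs_le.mp (hq n)
    exact_mod_cast (by linarith : a - C ≤ q n)
  have h2 : ∀ n, (q n : EReal) ≤ ((a + C : ℝ) : EReal) := fun n => by
    have := abs_le.mp (hq n)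
    exact_mod_cast (by linarith : q n ≤ a + C)
  -- Real bounds on both sides exclude the infinite values.
  have key : ∀ z : EReal, ((a - C : ℝ) : EReal) ≤ z → z ≤ ((a + C : ℝ) : EReal) →
      ∃ r : ℝ, z = r ∧ |r - a| ≤ C := by
    intro z hz1 hz2
    induction z with
    | bot => exact absurd (le_bot_iff.mp hz1) (EReal.coe_ne_bot _)
    | top => exact absurd (top_le_iff.mp hz2) (EReal.coe_ne_top _)
    | coe r =>
      refine ⟨r, rfl, abs_le.mpr ?_⟩
      have := EReal.coe_le_coe_iff.mp hz1
      have := EReal.coe_le_coe_iff.mp hz2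
      constructor <;> linarith
  have hlow : ((a - C : ℝ) : EReal) ≤ liminf (fun n => (q n : EReal)) atTop :=
    le_liminf_of_le (by isBoundedDefault) (Eventually.of_forall h1)
  have hupp : limsup (fun n => (q n : EReal)) atTop ≤ ((a + C : ℝ) : EReal) :=
    limsup_le_of_le (by isBoundedDefault) (Eventually.of_forall h2)
  have hle : liminf (fun n => (q n : EReal)) atTop ≤ limsup (fun n => (q n : EReal)) atTop :=
    liminf_le_limsup
  obtain ⟨l, hl, hla⟩ := key _ hlow (hle.trans hupp)
  obtain ⟨u, hu, hua⟩ := key _ (hlow.trans hle) hupp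
  exact ⟨l, u, hl, hu, hla, hua⟩

/-! ### Height-degree quotients on finite and infinite orbits -/

/-- On a finite right orbit the height-degree quotients tend to zero. -/
theorem limsup_heightQuotient_eq_zero_of_finite (hN : 1 ≤ N) (hS : HeightControlled S)
    {P : PN N} {γ : ℕ → S} (hP : (rightOrbit γ P).Finite) :
    limsup (heightQuotient γ P) atTop = 0 := by
  obtain ⟨B, hB⟩ := (hP.image weilHeight).bddAbove
  have hB' : ∀ n, weilHeight (rightIter γ n P) ≤ B := fun n =>
    hB ⟨_, ⟨n, rfl⟩, rfl⟩
  have hlim : Tendsto (fun n => weilHeight (rightIter γ n P) / (rightIter γ n).degree) atTop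
      (nhds 0) := by
    have hg : Tendsto (fun n : ℕ => B * (1 / 2 : ℝ) ^ n) atTop (nhds 0) := by
      simpa using (tendsto_pow_atTop_nhds_zero_of_lt_one (r := (1 / 2 : ℝ)) (by norm_num)
        (by norm_num)).const_mul B
    refine squeeze_zero (fun n => div_nonneg (weilHeight_nonneg _) (Nat.cast_nonneg _))
      (fun n => ?_) hg
    have h2 : (2 : ℝ) ^ n ≤ (rightIter γ n).degree := by
      exact_mod_cast two_pow_le_degree_rightIter hN hS γ n
    rw [one_div, inv_pow, ← div_eq_mul_inv]
    exact div_le_div₀ ((weilHeight_nonneg _).trans (hB' 0)) (hB' n) (by positivity) h2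
  have := (continuous_coe_real_ereal.tendsto 0).comp hlim
  exact this.limsup_eq

/-- If a word of large height recurs in `γ`, the height is infinitely often comparable to the
degree. -/
theorem frequently_degree_le_of_block (hN : 1 ≤ N) (hS : HeightControlled S) {C : ℝ}
    (hC0 : 0 ≤ C) (hC : ∀ (φ : S) (P : PN N),
      |weilHeight ((φ : ProjEndo N) P) - ((φ : ProjEndo N).degree : ℝ) * weilHeight P| ≤ C)
    {P : PN N} {m : ℕ} {w : ℕ → S} (hw : C + 1 < weilHeight (rightIter w m P)) {γ : ℕ → S}
    (hγ : ∃ᶠ n in atTop, ∀ i < m, γ (n + i) = w i) :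
    ∃ᶠ n in atTop, (1 / (rightIter w m).degree : ℝ) * (rightIter γ n).degree ≤
      weilHeight (rightIter γ n P) := by
  -- With `D` the degree of the `n`-th iterate, the height is at least `D * (C + 1) - C * D = D`,
  -- while the degree of the iterate at `n + m` is `D * deg w`; hence the factor `1 / deg w`.
  have key : ∀ n, (∀ i < m, γ (n + i) = w i) →
      (1 / (rightIter w m).degree : ℝ) * (rightIter γ (n + m)).degree ≤
        weilHeight (rightIter γ (n + m) P) := by
    intro n hn
    have hD := degree_rightIter_pos hN hS γ n
    have hd := degree_rightIter_pos hN hS w m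
    have h := abs_le.mp
      (abs_weilHeight_rightIter_sub_le hN hS hC0 hC γ n (rightIter w m P))
    rw [rightIter_add, rightIter_congr hn, ProjEndo.degree_mul hN, ProjEndo.mul_apply, Nat.cast_mul]
    have h3 : (1 / (rightIter w m).degree : ℝ) * ((rightIter γ n).degree * (rightIter w m).degree)
        = (rightIter γ n).degree := by field_simp
    rw [h3]
    nlinarith [h.1]
  refine (frequently_atTop.mpr fun a => ?_)
  obtain ⟨n, hn, hn'⟩ := frequently_atTop.mp hγ a
  exact ⟨n + m, by omega, key n hn'⟩

/-- If the total orbit of `P` is infinite then, almost surely, the heights along the right orbit are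
infinitely often at least a fixed positive multiple of the degree. -/
theorem exists_ae_frequently_mul_degree_le (hN : 1 ≤ N) (hS : HeightControlled S)
    (K : IntermediateField ℚ QBar) [FiniteDimensional ℚ K] (hSK : ∀ φ ∈ S, φ.IsDefinedOver K)
    (ν : Measure S) [IsProbabilityMeasure ν] (hν : ∀ φ : S, 0 < ν {φ}) {P : PN N}
    (hP : (totalOrbit S P).Infinite) :
    ∃ c : ℝ, 0 < c ∧ ∀ᵐ γ ∂(seqMeasure ν),
      ∃ᶠ n in atTop, c * (rightIter γ n).degree ≤ weilHeight (rightIter γ n P) := by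
  obtain ⟨C, hC0, hC⟩ := hS.exists_bound
  have : Nonempty S := nonempty_of_isProbabilityMeasure ν
  obtain ⟨f, hf, hfP⟩ := exists_lt_weilHeight_of_infinite K hSK hP (C + 1)
  obtain ⟨m, w, rfl⟩ := exists_rightIter_eq hf
  refine ⟨1 / (rightIter w m).degree, one_div_pos.mpr (degree_rightIter_pos hN hS w m), ?_⟩
  filter_upwards [ae_frequently_block_eq ν hν m w] with γ hγ
  exact frequently_degree_le_of_block hN hS hC0 hC hfP hγ

theorem limsup_heightQuotient_pos (hN : 1 ≤ N) (hS : HeightControlled S) {P : PN N} {γ : ℕ → S}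
    {c : ℝ} (hc : 0 < c)
    (h : ∃ᶠ n in atTop, c * (rightIter γ n).degree ≤ weilHeight (rightIter γ n P)) :
    0 < limsup (heightQuotient γ P) atTop := by
  refine (EReal.coe_pos.mpr hc).trans_le
    (le_limsup_of_frequently_le (h.mono fun n hn => ?_) (by isBoundedDefault))
  exact EReal.coe_le_coe_iff.mpr ((le_div_iff₀ (degree_rightIter_pos hN hS γ n)).mpr hn)

/-! ### The dynamical degree and the main theorem -/

instance ProjEndo.instDiscreteMeasurableSpace : DiscreteMeasurableSpace (ProjEndo N) :=
  ⟨fun _ => trivial⟩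

instance seqMeasure.instIsProbabilityMeasure (ν : Measure S) [IsProbabilityMeasure ν] :
    IsProbabilityMeasure (seqMeasure ν) := by
  unfold seqMeasure
  infer_instance

/-- The dynamical degree exists if the logarithm of the degree is integrable. -/
theorem isDynamicalDegree_exp_integral (hN : 1 ≤ N) (hS : HeightControlled S)
    (ν : Measure S) [IsProbabilityMeasure ν]
    (hint : Integrable (fun φ : S => Real.log ((φ : ProjEndo N).degree : ℝ)) ν) :
    IsDynamicalDegree ν (Real.exp (∫ φ : S, Real.log ((φ : ProjEndo N).degree : ℝ) ∂ν)) := by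
  have hmeas : Measurable fun φ : S => Real.log ((φ : ProjEndo N).degree : ℝ) :=
    (Measurable.of_discrete (f := fun φ : ProjEndo N => Real.log (φ.degree : ℝ))).comp
      measurable_subtype_coe
  filter_upwards [ae_tendsto_sum_div ν hmeas hint] with γ hγ
  have hpos : ∀ n, (0 : ℝ) < (γ n : ProjEndo N).degree := fun n => by
    exact_mod_cast two_pos.trans_le (hS.two_le_degree (γ n))
  have h := tendsto_prod_rpow_one_div hpos hγ
  -- Left and right iterates have the same degree, so one limit serves both.
  simp only [degree_leftIter hN, degree_rightIter hN, Nat.cast_prod]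
  exact ⟨h, h⟩

theorem theorem1p8 (N : ℕ) (hN : 1 ≤ N) (S : Set (ProjEndo N)) (hS : HeightControlled S)
    (K : IntermediateField ℚ QBar) (hK : FiniteDimensional ℚ K)
    (hSK : ∀ φ ∈ S, φ.IsDefinedOver K) :
    (∃ B : ℝ, ∀ (P : PN N) (γ : ℕ → S), ∃ l u : ℝ,
      liminf (heightQuotient γ P) atTop = (l : EReal) ∧
      limsup (heightQuotient γ P) atTop = (u : EReal) ∧
      |l - weilHeight P| ≤ B ∧ |u - weilHeight P| ≤ B) ∧
    ∀ (ν : Measure S) [IsProbabilityMeasure ν], (∀ φ : S, 0 < ν {φ}) →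
      (∀ P : PN N,
        ((totalOrbit S P).Infinite ↔
          ∀ᵐ γ ∂(seqMeasure ν), 0 < limsup (heightQuotient γ P) atTop) ∧
        ((totalOrbit S P).Finite ↔
          0 < seqMeasure ν {γ | (rightOrbit γ P).Finite})) ∧
      (Integrable (fun φ : S => Real.log ((φ : ProjEndo N).degree : ℝ)) ν →
        ∃ δ : ℝ, IsDynamicalDegree ν δ ∧
          δ = Real.exp (∫ φ : S, Real.log ((φ : ProjEndo N).degree : ℝ) ∂ν) ∧
          ∀ P : PN N, (totalOrbit S P).Infinite →
            ∀ᵐ γ ∂(seqMeasure ν),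
              limsup (fun n : ℕ =>
                ((weilHeight (rightIter γ n P) ^ (1 / (n : ℝ)) : ℝ) : EReal)) atTop
                  = (δ : EReal)) := by

  obtain ⟨C, hC0, hC⟩ := hS.exists_bound
  refine ⟨⟨C, fun P γ => exists_liminf_limsup_eq fun n =>
    abs_weilHeight_div_degree_sub_le hN hS hC0 hC γ n P⟩, fun ν _ hν => ⟨fun P => ?_, fun hint => ?_⟩⟩
  · have hinf : (totalOrbit S P).Infinite →
        ∀ᵐ γ ∂(seqMeasure ν), 0 < limsup (heightQuotient γ P) atTop := fun hP => by
      obtain ⟨c, hc, h⟩ := exists_ae_frequently_mul_degree_le hN hS K hSK ν hν hP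
      filter_upwards [h] with γ hγ
      exact limsup_heightQuotient_pos hN hS hc hγ
    have hfin : (totalOrbit S P).Finite → ∀ γ : ℕ → S, (rightOrbit γ P).Finite := fun hP γ =>
      hP.subset (rightOrbit_subset_totalOrbit γ P)
    refine ⟨⟨hinf, fun h hP => ?_⟩, fun hP => ?_, fun h => ?_⟩
    · obtain ⟨γ, hγ⟩ := h.exists
      exact hγ.ne' (limsup_heightQuotient_eq_zero_of_finite hN hS (hfin hP γ))
    · simp [hfin hP]
    · by_contra hP
      -- Sequences with finite right orbit have upper limit `0`, so they lie in the null set where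
      -- positivity fails; their own measurability is not needed.
      refine h.ne' (measure_mono_null (fun γ hγ => ?_) (ae_iff.mp (hinf hP)))
      exact fun hpos => hpos.ne' (limsup_heightQuotient_eq_zero_of_finite hN hS hγ)
  · have hδ := isDynamicalDegree_exp_integral hN hS ν hint
    refine ⟨_, hδ, rfl, fun P hP => ?_⟩
    obtain ⟨c, hc, h⟩ := exists_ae_frequently_mul_degree_le hN hS K hSK ν hν hP
    filter_upwards [h, hδ] with γ hγ hγδ
    have hh := weilHeight_nonneg P
    -- The uniform estimate gives the factor `h(P) + C`; adding `1` keeps it positive when both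
    -- terms vanish.
    refine limsup_rpow_one_div_eq hc (c' := weilHeight P + C + 1) (by positivity)
      (fun n => Nat.cast_nonneg _) (fun n => weilHeight_nonneg _) hγδ.2 (fun n => ?_) hγ
    have hD := degree_rightIter_pos hN hS γ n
    have := (abs_le.mp (abs_weilHeight_rightIter_sub_le hN hS hC0 hC γ n P)).2
    linarith
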